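/- Let $\tau=(1+\sqrt5)/2$, $K=\mathbb Q(\sqrt5)$ and $\mathfrak o=\mathbb Z[\tau]$, and let $'$ denote the algebraic conjugation of $K$ (given by $\sqrt5\mapsto-\sqrt5$). Let $\mathbb H(K)=K\oplus \mathrm iK\oplus \mathrm jK\oplus \mathrm kK$ be the Hamilton quaternion algebra over $K$, whose elements are written $(a,b,c,d)=a+\mathrm ib+\mathrm jc+\mathrm kd$; it is contained in $\mathbb H(\mathbb R)=\mathbb R^4$, and $|\cdot|$ is the Euclidean length. For $q=(a,b,c,d)\in\mathbb H(K)$ put $\tilde q=(a',b',d',c')$. The icosian ring $\mathbb I$ is the set of all $\mathfrak o$-linear combinations of $(1,0,0,0)$, $(0,1,0,0)$, $\frac12(1,1,1,1)$, $\frac12(1-\tau,\tau,0,1)$. An icosian $q\in\mathbb I$ is called primitive if, for $\alpha\in K$, $\alpha q\in\mathbb I$ implies $\alpha\in\mathfrak o$; it is called admissible if $|q\tilde q|$ is a positive integer. Let $$L=\bigl\langle (1,0,0,0),\ \tfrac12(-1,1,1,1),\ (0,-1,0,0),\ \tfrac12(0,1,\tau-1,-\tau)\bigr\rangle_{\mathbb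 Z}\subset\mathbb R^4,$$ a copy of the root lattice $A_4$. A coincidence site lattice (CSL) of $L$ is a lattice of the form $L\cap RL$, where $R\in\mathrm O(4,\mathbb R)$ is an isometry for which the index $[L:(L\cap RL)]$ is finite. Theorem. The CSLs of $L$ are precisely the lattices of the form $$L\cap\frac{1}{|q\tilde q|}\,qL\tilde q$$ with $q\in\mathbb I$ primitive and admissible. -/

import Mathlib

open scoped Quaternion

noncomputable section

namespace A4CSL

/-! ### Coincidence site lattices of a lattice in a Euclidean space -/

section CSL

variable {E : Type*} [NormedAddCommGroup E] [InnerProductSpace ℝ E]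

/-- The image `R Γ` of a lattice under a linear isometry `R` (an element of the orthogonal group). -/
def isometryImage (R : E ≃ₗᵢ[ℝ] E) (Γ : Submodule ℤ E) : Submodule ℤ E :=
  Γ.map (R.toLinearEquiv.toLinearMap.restrictScalars ℤ)

/-- The coincidence index `[Γ : Γ ∩ R Γ]`, with the value `0` when the index is infinite. -/
def coincidenceIndex (Γ : Submodule ℤ E) (R : E ≃ₗᵢ[ℝ] E) : ℕ :=
  (Γ ⊓ isometryImage R Γ).toAddSubgroup.relIndex Γ.toAddSubgroup

/-- `R` is a coincidence isometry of `Γ`: the index `[Γ : Γ ∩ R Γ]` is finite. -/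
def IsCoincidenceIsometry (Γ : Submodule ℤ E) (R : E ≃ₗᵢ[ℝ] E) : Prop :=
  coincidenceIndex Γ R ≠ 0

/-- `Λ` is a coincidence site lattice of `Γ`: it is `Γ ∩ R Γ` for a coincidence isometry `R`. -/
def IsCSL (Γ Λ : Submodule ℤ E) : Prop :=
  ∃ R : E ≃ₗᵢ[ℝ] E, IsCoincidenceIsometry Γ R ∧ Λ = Γ ⊓ isometryImage R Γ

end CSL

/-- The quaternion `(a, b, c, d) = a + b i + c j + d k`. -/
def quat {R : Type*} [CommRing R] (a b c d : R) : ℍ[R] := ⟨a, b, c, d⟩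

/-! ### The field `K = ℚ(√5)`, its integers, and the icosians -/

/-- `K = ℚ(√5)`; the element `⟨q, r⟩` is `q + r √5`. The algebraic conjugation `√5 ↦ -√5` is
`star`. -/
abbrev K : Type := QuadraticAlgebra ℚ 5 0

/-- The golden ratio `τ = (1 + √5) / 2` as an element of `K`. -/
def tau : K := ⟨1 / 2, 1 / 2⟩

/-- The set `ℤ[τ] = {m + n τ | m, n ∈ ℤ}`, the ring of integers of `K`. -/
def goldenIntegers : Set K := {z | ∃ m n : ℤ, z = (m : K) + (n : K) * tau}

/-- The inclusion of `K` into `ℝ`, sending `q + r √5` to the real number `q + r √5`. -/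
def toReal (z : K) : ℝ := (z.re : ℝ) + (z.im : ℝ) * √5

/-- The inclusion of `ℍ(K)` into the real quaternions `ℍ(ℝ) = ℝ⁴`. -/
def embed (q : ℍ[K]) : ℍ[ℝ] :=
  quat (toReal q.re) (toReal q.imI) (toReal q.imJ) (toReal q.imK)

/-- The icosian ring: all `ℤ[τ]`-linear combinations of `(1,0,0,0)`, `(0,1,0,0)`,
`(1,1,1,1)/2` and `(1-τ,τ,0,1)/2`. -/
def icosians : Set ℍ[K] :=
  {x | ∃ a ∈ goldenIntegers, ∃ b ∈ goldenIntegers, ∃ c ∈ goldenIntegers, ∃ d ∈ goldenIntegers,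
    x = a • quat 1 0 0 0 + b • quat 0 1 0 0
      + c • ((1 / 2 : ℚ) • quat 1 1 1 1)
      + d • ((1 / 2 : ℚ) • quat (1 - tau) tau 0 1)}

/-- The twist map `(a, b, c, d) ↦ (a', b', d', c')`, where `'` is the conjugation of `K`. -/
def twist (q : ℍ[K]) : ℍ[K] :=
  quat (star q.re) (star q.imI) (star q.imK) (star q.imJ)

/-- An icosian `q` is primitive if `α q` is an icosian, with `α ∈ K`, only for `α ∈ ℤ[τ]`. -/
def IsPrimitive (q : ℍ[K]) : Prop :=
  ∀ α : K, α • q ∈ icosians → α ∈ goldenIntegers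

/-- The Euclidean length `|q q̃|`. -/
def twistLength (q : ℍ[K]) : ℝ := ‖embed (q * twist q)‖

/-- `q` is admissible if `|q q̃|` is a positive integer. -/
def IsAdmissible (q : ℍ[K]) : Prop :=
  ∃ n : ℕ, 0 < n ∧ twistLength q = n

/-! ### The lattice `L` -/

/-- The lattice `L` in `ℝ⁴ = ℍ(ℝ)`, a copy of the root lattice `A₄`. -/
def L : Submodule ℤ ℍ[ℝ] :=
  Submodule.span ℤ
    {quat 1 0 0 0,
     (1 / 2 : ℝ) • quat (-1) 1 1 1,
     quat 0 (-1) 0 0,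
     (1 / 2 : ℝ) • quat 0 1 (Real.goldenRatio - 1) (-Real.goldenRatio)}

/-- The set `(1 / |q q̃|) q L q̃`. -/
def rotatedL (q : ℍ[K]) : Set ℍ[ℝ] :=
  (fun x : ℍ[ℝ] => (1 / twistLength q) • (embed q * x * embed (twist q))) '' (L : Set ℍ[ℝ])

end A4CSL

end

noncomputable section

namespace A4CSL

/-! ### The embedding and the twist -/

section quat

variable {R : Type*} [CommRing R] (a b c d : R)

/-! The rational span of `L` is the space V of twist-fixed elements of `ℍ[K]`
(`exists_embed_eq_of_mem_L`, `exists_nsmul_embed_mem_L`). Since `L` is finitely generated, finite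
index amounts to compatibility with V.

If R is a coincidence isometry, R⁻¹ maps V into V. As V spans `ℍ[K]` over `K`, Cayley's description
(`exists_mul_mul_of_isometry`) gives R⁻¹, up to quaternion conjugation, as x ↦ p x q with p, q over
`K`. Preserving V forces p to be a rational multiple of the twist of q (`exists_twistedConj_eq`), so
R is a rational multiple of x ↦ r x r̃, up to conjugation, under which `L` is stable. Scaling r by a
∈ `K` only introduces the rational factor N(a), so r may be taken to be a primitive icosian
(`exists_smul_isPrimitive`). Then |r r̃| is rational and its square is an integer, so r is
admissible.

Conversely, for admissible q the normalised map is an isometry whose inverse preserves V, and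
clearing denominators gives finite index. -/

@[simp] lemma quat_re : (quat a b c d).re = a := rfl
@[simp] lemma quat_imI : (quat a b c d).imI = b := rfl
@[simp] lemma quat_imJ : (quat a b c d).imJ = c := rfl
@[simp] lemma quat_imK : (quat a b c d).imK = d := rfl

end quat

@[simp] lemma embed_re (q : ℍ[K]) : (embed q).re = toReal q.re := rfl
@[simp] lemma embed_imI (q : ℍ[K]) : (embed q).imI = toReal q.imI := rfl
@[simp] lemma embed_imJ (q : ℍ[K]) : (embed q).imJ = toReal q.imJ := rfl
@[simp] lemma embed_imK (q : ℍ[K]) : (embed q).imK = toReal q.imK := rfl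

@[simp] lemma twist_re (q : ℍ[K]) : (twist q).re = star q.re := rfl
@[simp] lemma twist_imI (q : ℍ[K]) : (twist q).imI = star q.imI := rfl
@[simp] lemma twist_imJ (q : ℍ[K]) : (twist q).imJ = star q.imK := rfl
@[simp] lemma twist_imK (q : ℍ[K]) : (twist q).imK = star q.imJ := rfl


/-- Irrationality of √5; this instance is what makes `K` a field. -/
instance : Fact (∀ r : ℚ, r ^ 2 ≠ 5 + 0 * r) := ⟨fun r h => by
  have h5 : Irrational √(5 : ℝ) := by simpa using Nat.Prime.irrational_sqrt (p := 5) (by norm_num)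
  refine h5 ⟨|r|, ?_⟩
  have h' : ((|r| : ℚ) : ℝ) ^ 2 = 5 := by
    rw [← Rat.cast_pow, sq_abs, h]; norm_num
  rw [← h', Real.sqrt_sq (by exact_mod_cast abs_nonneg r)]⟩

/-- `toReal` as a ring homomorphism. -/
def toRealHom : K →+* ℝ where
  toFun := toReal
  map_one' := by simp [toReal, QuadraticAlgebra.re_one, QuadraticAlgebra.im_one]
  map_zero' := by simp [toReal]
  map_add' x y := by simp [toReal]; ring
  map_mul' x y := by
    have h : √(5 : ℝ) * √5 = 5 := Real.mul_self_sqrt (by norm_num)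
    simp [toReal]
    linear_combination (-(x.im : ℝ) * y.im) * h

lemma toRealHom_apply (x : K) : toRealHom x = toReal x := rfl

/-- `embed` as a ring homomorphism. -/
def embedHom : ℍ[K] →+* ℍ[ℝ] where
  toFun := embed
  map_one' := by
    ext <;> simp [← toRealHom_apply]
  map_zero' := by
    ext <;> simp [← toRealHom_apply]
  map_add' x y := by
    ext <;> simp [← toRealHom_apply]
  map_mul' x y := by
    ext <;> simp [← toRealHom_apply, -QuadraticAlgebra.re_mul]

@[simp] lemma embedHom_apply (x : ℍ[K]) : embedHom x = embed x := rfl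

lemma embed_mul (x y : ℍ[K]) : embed (x * y) = embed x * embed y := embedHom.map_mul x y
lemma embed_one : embed 1 = 1 := embedHom.map_one
lemma embed_zero : embed 0 = 0 := embedHom.map_zero

lemma embed_star (x : ℍ[K]) : embed (star x) = star (embed x) := by
  ext <;> simp [← toRealHom_apply]

lemma embed_smul (a : K) (x : ℍ[K]) : embed (a • x) = toReal a • embed x := by
  ext <;> simp [← toRealHom_apply]

lemma toReal_injective : Function.Injective toReal := toRealHom.injective

lemma toReal_ratCast (r : ℚ) : toReal (r : K) = r := by
  exact map_ratCast toRealHom r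

lemma embed_injective : Function.Injective embed := fun x y h => by
  have h1 := congrArg (fun q : ℍ[ℝ] => q.re) h
  have h2 := congrArg (fun q : ℍ[ℝ] => q.imI) h
  have h3 := congrArg (fun q : ℍ[ℝ] => q.imJ) h
  have h4 := congrArg (fun q : ℍ[ℝ] => q.imK) h
  ext1
  · exact toReal_injective h1
  · exact toReal_injective h2
  · exact toReal_injective h3
  · exact toReal_injective h4

/-- Exchanging j and k while fixing i reverses products, e.g. ij = k becomes ki = j. -/
lemma twist_mul (x y : ℍ[K]) : twist (x * y) = twist y * twist x := by
  ext1 <;> simp [-QuadraticAlgebra.re_mul] <;> ring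

@[simp] lemma twist_twist (x : ℍ[K]) : twist (twist x) = x := by
  ext1 <;> simp

lemma twist_smul (a : K) (x : ℍ[K]) : twist (a • x) = star a • twist x := by
  ext1 <;> simp [-QuadraticAlgebra.re_mul]

lemma twist_one : twist 1 = 1 := by
  ext1 <;> simp

lemma twist_star (x : ℍ[K]) : twist (star x) = star (twist x) := by
  ext1 <;> simp

lemma star_ratCast (r : ℚ) : star (r : K) = r := by
  ext <;> simp

lemma exists_ratCast_eq {a : K} (h : star a = a) : ∃ r : ℚ, a = r := by
  refine ⟨a.re, ?_⟩
  have := congrArg QuadraticAlgebra.im h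
  simp at this
  ext <;> simp
  linarith

lemma ratCast_smul_eq (r : ℚ) (x : ℍ[K]) : (r : K) • x = r • x := by
  ext <;> simp 

/-- Two-sided inverses in `ℍ[K]`. -/
lemma exists_inverse {q : ℍ[K]} (hq : q ≠ 0) : ∃ r : ℍ[K], r * q = 1 ∧ q * r = 1 ∧
    embed r = (embed q)⁻¹ := by
  have h0 : embed q ≠ 0 := fun h => hq (embed_injective (h.trans embed_zero.symm))
  have h1 : embed (((Quaternion.normSq q)⁻¹ : K) • star q) = (embed q)⁻¹ := by
    rw [embed_smul, embed_star, Quaternion.inv_def]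
    congr 1
    rw [← toRealHom_apply, map_inv₀]
    congr 1
    simp only [Quaternion.normSq_def', map_add, map_pow]
    rfl
  refine ⟨_, embed_injective ?_, embed_injective ?_, h1⟩
  · rw [embed_mul, h1, embed_one, inv_mul_cancel₀ h0]
  · rw [embed_mul, h1, embed_one, mul_inv_cancel₀ h0]

/-! ### The lattice `L` -/

lemma mem_L_iff (x : ℍ[ℝ]) : x ∈ L ↔ ∃ m n k l : ℤ,
    x = quat (m - n / 2 : ℝ) (n / 2 - k + l / 2) (n / 2 + l * (√5 - 1) / 4)
      (n / 2 - l * (√5 + 1) / 4) := by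
  simp only [L, Submodule.mem_span_insert, Submodule.mem_span_singleton]
  constructor
  · rintro ⟨m, _, ⟨n, _, ⟨k, _, ⟨l, rfl⟩, rfl⟩, rfl⟩, rfl⟩
    refine ⟨m, n, k, l, ?_⟩
    ext <;> simp [Real.goldenRatio] <;> ring
  · rintro ⟨m, n, k, l, rfl⟩
    refine ⟨m, _, ⟨n, _, ⟨k, _, ⟨l, rfl⟩, rfl⟩, rfl⟩, ?_⟩
    ext <;> simp [Real.goldenRatio] <;> ring

lemma exists_embed_eq_of_mem_L {x : ℍ[ℝ]} (hx : x ∈ L) :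
    ∃ y, twist y = y ∧ embed y = x := by
  obtain ⟨m, n, k, l, rfl⟩ := (mem_L_iff x).1 hx
  refine ⟨quat ⟨m - n / 2, 0⟩ ⟨n / 2 - k + l / 2, 0⟩ ⟨n / 2 - l / 4, l / 4⟩
    ⟨n / 2 - l / 4, - l / 4⟩, ?_, ?_⟩
  · ext <;> simp <;> ring
  · ext <;> simp [toReal] <;> ring

lemma exists_nat_mul_eq_int (r : ℚ) (n : ℕ) (h : r.den ∣ n) : ∃ m : ℤ, (n : ℝ) * r = m := by
  obtain ⟨k, rfl⟩ := h
  refine ⟨k * r.num, ?_⟩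
  have : (r.den : ℝ) * r = r.num := by exact_mod_cast r.den_mul_eq_num
  push_cast
  linear_combination (k : ℝ) * this

/-- Being twist-fixed means coordinates (a, b, s + t√5, s − t√5) with a, b, s, t rational, so it
suffices to clear denominators. -/
lemma exists_nsmul_embed_mem_L {y : ℍ[K]} (hy : twist y = y) :
    ∃ n : ℕ, n ≠ 0 ∧ n • embed y ∈ L := by
  have h1 := congrArg (fun q : ℍ[K] => q.re.im) hy
  have h2 := congrArg (fun q : ℍ[K] => q.imI.im) hy
  have h3 := congrArg (fun q : ℍ[K] => q.imK.re) hy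
  have h4 := congrArg (fun q : ℍ[K] => q.imK.im) hy
  simp only [twist_re, twist_imI, twist_imK, QuadraticAlgebra.im_star, QuadraticAlgebra.re_star,
    zero_mul, add_zero] at h1 h2 h3 h4
  replace h1 : y.re.im = 0 := by linarith
  replace h2 : y.imI.im = 0 := by linarith
  set a := y.re.re
  set b := y.imI.re
  set s := y.imJ.re
  set t := y.imJ.im
  obtain ⟨A, hA⟩ := exists_nat_mul_eq_int a (a.den * b.den * s.den * t.den)
    ⟨b.den * s.den * t.den, by ring⟩
  obtain ⟨B, hB⟩ := exists_nat_mul_eq_int b (a.den * b.den * s.den * t.den)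
    ⟨a.den * s.den * t.den, by ring⟩
  obtain ⟨C, hC⟩ := exists_nat_mul_eq_int s (a.den * b.den * s.den * t.den)
    ⟨a.den * b.den * t.den, by ring⟩
  obtain ⟨D, hD⟩ := exists_nat_mul_eq_int t (a.den * b.den * s.den * t.den)
    ⟨a.den * b.den * s.den, by ring⟩
  refine ⟨a.den * b.den * s.den * t.den, by positivity, ?_⟩
  generalize (a.den * b.den * s.den * t.den) = n at *
  -- Solution of the linear system in `mem_L_iff` for the vector (A, B, C + D√5, C − D√5).
  refine (mem_L_iff _).2 ⟨A + C + D, 2 * C + 2 * D, C + 3 * D - B, 4 * D, ?_⟩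
  push_cast
  rw [← hA, ← hB, ← hC, ← hD]
  ext
  · simp [toReal, h1, a]; ring
  · simp [toReal, h2, b]; ring
  · simp [toReal, s, t]; ring
  · simp [toReal, ← h3, ← h4, s, t]; ring

/-- Lets orientation-reversing isometries be replaced by orientation-preserving ones with the same
image of `L`. -/
lemma star_mem_L {x : ℍ[ℝ]} (hx : x ∈ L) : star x ∈ L := by
  obtain ⟨m, n, k, l, rfl⟩ := (mem_L_iff x).1 hx
  refine (mem_L_iff _).2 ⟨m - n, -n, -k, -l, ?_⟩
  ext <;> simp <;> ring

/-! ### Golden integers and primitive multiples -/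

lemma goldenIntegers_eq (m n : ℤ) : (m : K) + (n : K) * tau = ⟨m + n / 2, n / 2⟩ := by
  ext <;> simp [tau] <;> ring

lemma mem_goldenIntegers_iff (z : K) :
    z ∈ goldenIntegers ↔ ∃ m n : ℤ, z = ⟨m + n / 2, n / 2⟩ := by
  simp only [← goldenIntegers_eq]; rfl

/-- `ℤ[τ]` as a subring of `K`. -/
def goldenSubring : Subring K where
  carrier := goldenIntegers
  mul_mem' := by
    simp only [mem_goldenIntegers_iff]
    rintro _ _ ⟨m, n, rfl⟩ ⟨k, l, rfl⟩
    refine ⟨m * k + n * l, m * l + n * k + n * l, ?_⟩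
    ext <;> simp <;> ring
  one_mem' := (mem_goldenIntegers_iff _).2 ⟨1, 0, by
    ext <;> simp [QuadraticAlgebra.re_one, QuadraticAlgebra.im_one]⟩
  zero_mem' := (mem_goldenIntegers_iff _).2 ⟨0, 0, by ext <;> simp⟩
  add_mem' := by
    simp only [mem_goldenIntegers_iff]
    rintro _ _ ⟨m, n, rfl⟩ ⟨k, l, rfl⟩
    refine ⟨m + k, n + l, ?_⟩
    ext <;> simp <;> ring
  neg_mem' := by
    simp only [mem_goldenIntegers_iff]
    rintro _ ⟨m, n, rfl⟩
    refine ⟨-m, -n, ?_⟩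
    ext <;> simp <;> ring

lemma tau_mem : tau ∈ goldenSubring :=
  (mem_goldenIntegers_iff _).2 ⟨0, 1, by ext <;> simp [tau]⟩

lemma exists_norm_eq_int {z : K} (hz : z ∈ goldenSubring) :
    ∃ m : ℤ, QuadraticAlgebra.norm z = m := by
  obtain ⟨m, n, rfl⟩ := (mem_goldenIntegers_iff z).1 hz
  refine ⟨m ^ 2 + m * n - n ^ 2, ?_⟩
  simp [QuadraticAlgebra.norm_def]
  ring

/-- `ℤ[τ]` is norm-Euclidean. -/
lemma exists_goldenInteger_norm_sub_lt_one (z : K) :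
    ∃ m ∈ goldenSubring, |QuadraticAlgebra.norm (z - m)| < 1 := by
  obtain ⟨a, b⟩ := z
  -- In the basis 1, τ the element is (a − b) + 2bτ; both coordinates are rounded, and N(x + yτ) =
  -- x² + xy − y² is small for |x|, |y| ≤ 1/2.
  set n := round (2 * b)
  set m := round (a - b)
  refine ⟨⟨m + n / 2, n / 2⟩, (mem_goldenIntegers_iff _).2 ⟨m, n, rfl⟩, ?_⟩
  have h1 := abs_le.1 (abs_sub_round (2 * b))
  have h2 := abs_le.1 (abs_sub_round (a - b))
  have : QuadraticAlgebra.norm ((⟨a, b⟩ : K) - ⟨m + n / 2, n / 2⟩) =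
      (a - b - m) ^ 2 + (a - b - m) * (2 * b - n) - (2 * b - n) ^ 2 := by
    simp [QuadraticAlgebra.norm_def]; ring
  rw [this]
  change -(1/2) ≤ 2 * b - n ∧ 2 * b - n ≤ 1/2 at h1
  change -(1/2) ≤ a - b - m ∧ a - b - m ≤ 1/2 at h2
  generalize a - b - (m : ℚ) = x at *
  generalize 2 * b - (n : ℚ) = y at *
  rw [abs_lt]
  constructor <;> nlinarith

/-- The coordinates of an element of `ℍ[K]` with respect to the basis of the icosians. -/
lemma icosian_coordinates (a b c d : K) :
    a • quat 1 0 0 0 + b • quat 0 1 0 0 + c • ((1 / 2 : ℚ) • quat 1 1 1 1)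
      + d • ((1 / 2 : ℚ) • quat (1 - tau) tau 0 1) =
    quat (a + c * (1 / 2 : ℚ) + d * (1 / 2 : ℚ) * (1 - tau))
      (b + c * (1 / 2 : ℚ) + d * (1 / 2 : ℚ) * tau)
      (c * (1 / 2 : ℚ)) ((c + d) * (1 / 2 : ℚ)) := by
  simp only [← ratCast_smul_eq]
  ext1 <;> simp only [Quaternion.re_add, Quaternion.imI_add, Quaternion.imJ_add, Quaternion.imK_add,
    Quaternion.re_smul, Quaternion.imI_smul, Quaternion.imJ_smul, Quaternion.imK_smul, quat_re,
    quat_imI, quat_imJ, quat_imK, smul_eq_mul] <;> ring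

lemma mem_icosians_iff (x : ℍ[K]) : x ∈ icosians ↔
    2 * x.imJ ∈ goldenSubring ∧ 2 * (x.imK - x.imJ) ∈ goldenSubring ∧
    x.re - x.imJ - (x.imK - x.imJ) * (1 - tau) ∈ goldenSubring ∧
    x.imI - x.imJ - (x.imK - x.imJ) * tau ∈ goldenSubring := by
  have h2 : ((1 / 2 : ℚ) : K) = 1 / 2 := by push_cast; rfl
  simp only [icosians, icosian_coordinates, Set.mem_ofPred_eq, h2]
  constructor
  · rintro ⟨a, ha, b, hb, c, hc, d, hd, rfl⟩
    change a ∈ goldenSubring at ha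
    change b ∈ goldenSubring at hb
    change c ∈ goldenSubring at hc
    change d ∈ goldenSubring at hd
    simp only [quat_re, quat_imI, quat_imJ, quat_imK]
    refine ⟨?_, ?_, ?_, ?_⟩
    · convert hc using 1; ring
    · convert hd using 1; ring
    · convert ha using 1; ring
    · convert hb using 1; ring
  · rintro ⟨hc, hd, ha, hb⟩
    refine ⟨_, ha, _, hb, _, hc, _, hd, ?_⟩
    ext1 <;> simp only [quat_re, quat_imI, quat_imJ, quat_imK] <;> ring

lemma icosians_smul_mem {a : K} (ha : a ∈ goldenSubring) {x : ℍ[K]} (hx : x ∈ icosians) :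
    a • x ∈ icosians := by
  rw [mem_icosians_iff] at *
  obtain ⟨h1, h2, h3, h4⟩ := hx
  simp only [Quaternion.re_smul, Quaternion.imI_smul, Quaternion.imJ_smul, Quaternion.imK_smul,
    smul_eq_mul]
  refine ⟨?_, ?_, ?_, ?_⟩
  · convert mul_mem ha h1 using 1; ring
  · convert mul_mem ha h2 using 1; ring
  · convert mul_mem ha h3 using 1; ring
  · convert mul_mem ha h4 using 1; ring

lemma icosians_sub_mem {x y : ℍ[K]} (hx : x ∈ icosians) (hy : y ∈ icosians) :
    x - y ∈ icosians := by
  rw [mem_icosians_iff] at *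
  obtain ⟨h1, h2, h3, h4⟩ := hx
  obtain ⟨k1, k2, k3, k4⟩ := hy
  simp only [Quaternion.re_sub, Quaternion.imI_sub, Quaternion.imJ_sub, Quaternion.imK_sub]
  refine ⟨?_, ?_, ?_, ?_⟩
  · convert sub_mem h1 k1 using 1; ring
  · convert sub_mem h2 k2 using 1; ring
  · convert sub_mem h3 k3 using 1; ring
  · convert sub_mem h4 k4 using 1; ring

lemma tau_sq : tau * tau = tau + 1 := by
  ext <;> simp [tau, QuadraticAlgebra.re_one, QuadraticAlgebra.im_one] <;> norm_num

/-- In the icosian basis the norm form has coefficients in ℤ[τ]; the d² term uses (1 − τ)² + τ² + 1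
= 4. -/
lemma normSq_mem_of_mem_icosians {x : ℍ[K]} (hx : x ∈ icosians) :
    Quaternion.normSq x ∈ goldenSubring := by
  rw [mem_icosians_iff] at hx
  obtain ⟨hc, hd, ha, hb⟩ := hx
  rw [Quaternion.normSq_def']
  set c := 2 * x.imJ with hc'
  set d := 2 * (x.imK - x.imJ) with hd'
  set a := x.re - x.imJ - (x.imK - x.imJ) * (1 - tau) with ha'
  set b := x.imI - x.imJ - (x.imK - x.imJ) * tau with hb'
  have e3 : x.imJ = c / 2 := by rw [hc']; ring
  have e4 : x.imK = (c + d) / 2 := by rw [hc', hd']; ring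
  have e1 : x.re = a + c / 2 + d / 2 * (1 - tau) := by rw [hc', hd', ha']; ring
  have e2 : x.imI = b + c / 2 + d / 2 * tau := by rw [hc', hd', hb']; ring
  have : x.re ^ 2 + x.imI ^ 2 + x.imJ ^ 2 + x.imK ^ 2 = a * a + b * b + c * c + d * d + a * c
      + a * d * (1 - tau) + b * c + b * d * tau + c * d := by
    rw [e1, e2, e3, e4]
    linear_combination (d ^ 2 / 2) * tau_sq
  rw [this]
  have ht := tau_mem
  have h1 := sub_mem (one_mem goldenSubring) ht
  exact add_mem (add_mem (add_mem (add_mem (add_mem (add_mem (add_mem (add_mem (mul_mem ha ha)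
    (mul_mem hb hb)) (mul_mem hc hc)) (mul_mem hd hd)) (mul_mem ha hc))
    (mul_mem (mul_mem ha hd) h1)) (mul_mem hb hc)) (mul_mem (mul_mem hb hd) ht)) (mul_mem hc hd)

lemma exists_natCast_mul_mem (z : K) : ∃ n : ℕ, n ≠ 0 ∧ (n : K) * z ∈ goldenSubring := by
  obtain ⟨a, b⟩ := z
  refine ⟨a.den * b.den, by positivity, (mem_goldenIntegers_iff _).2
    ⟨b.den * a.num - a.den * b.num, 2 * a.den * b.num, ?_⟩⟩
  have ha : (a.den : ℚ) * a = a.num := a.den_mul_eq_num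
  have hb : (b.den : ℚ) * b = b.num := b.den_mul_eq_num
  generalize a.num = m at *
  generalize b.num = n at *
  ext
  · simp; linear_combination (b.den : ℚ) * ha
  · simp; linear_combination (a.den : ℚ) * hb

lemma exists_natCast_smul_mem_icosians (q : ℍ[K]) : ∃ n : ℕ, n ≠ 0 ∧ (n : K) • q ∈ icosians := by
  obtain ⟨n₁, h₁, g₁⟩ := exists_natCast_mul_mem (2 * q.imJ)
  obtain ⟨n₂, h₂, g₂⟩ := exists_natCast_mul_mem (2 * (q.imK - q.imJ))
  obtain ⟨n₃, h₃, g₃⟩ := exists_natCast_mul_mem (q.re - q.imJ - (q.imK - q.imJ) * (1 - tau))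
  obtain ⟨n₄, h₄, g₄⟩ := exists_natCast_mul_mem (q.imI - q.imJ - (q.imK - q.imJ) * tau)
  refine ⟨n₁ * n₂ * n₃ * n₄, by positivity, (mem_icosians_iff _).2 ?_⟩
  simp only [Quaternion.re_smul, Quaternion.imI_smul, Quaternion.imJ_smul, Quaternion.imK_smul,
    smul_eq_mul, Nat.cast_mul]
  refine ⟨?_, ?_, ?_, ?_⟩
  · convert mul_mem (natCast_mem goldenSubring (n₂ * n₃ * n₄)) g₁ using 1; push_cast; ring
  · convert mul_mem (natCast_mem goldenSubring (n₁ * n₃ * n₄)) g₂ using 1; push_cast; ring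
  · convert mul_mem (natCast_mem goldenSubring (n₁ * n₂ * n₄)) g₃ using 1; push_cast; ring
  · convert mul_mem (natCast_mem goldenSubring (n₁ * n₂ * n₃)) g₄ using 1; push_cast; ring

lemma toReal_normSq (q : ℍ[K]) : toReal (Quaternion.normSq q) = Quaternion.normSq (embed q) := by
  rw [← toRealHom_apply]
  simp only [Quaternion.normSq_def', map_add, map_pow]
  rfl

lemma normSq_ne_zero {q : ℍ[K]} (hq : q ≠ 0) : Quaternion.normSq q ≠ 0 := fun h => by
  have := toReal_normSq q
  rw [h, ← toRealHom_apply, map_zero, eq_comm, Quaternion.normSq_eq_zero] at this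
  exact hq (embed_injective (this.trans embed_zero.symm))

/-- Every nonzero element of `ℍ[K]` is proportional to a primitive icosian. -/
lemma exists_smul_isPrimitive {q : ℍ[K]} (hq : q ≠ 0) :
    ∃ a : K, a ≠ 0 ∧ a • q ∈ icosians ∧ IsPrimitive (a • q) := by
  classical
  -- Descent: choose the icosian multiple of q whose reduced norm has least absolute field norm.
  have hex : ∃ n : ℕ, ∃ a : K, a ≠ 0 ∧ a • q ∈ icosians ∧
      |QuadraticAlgebra.norm (Quaternion.normSq (a • q))| = n := by
    obtain ⟨n, hn, h⟩ := exists_natCast_smul_mem_icosians q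
    obtain ⟨m, hm⟩ := exists_norm_eq_int (normSq_mem_of_mem_icosians h)
    exact ⟨m.natAbs, n, Nat.cast_ne_zero.2 hn, h, by rw [hm]; simp⟩
  obtain ⟨a, ha, haq, hn⟩ := Nat.find_spec hex
  refine ⟨a, ha, haq, fun b hb => ?_⟩
  -- Subtracting a near golden integer from b leaves a multiplier of norm below 1; unless it
  -- vanishes, it contradicts minimality.
  obtain ⟨m, hm, hlt⟩ := exists_goldenInteger_norm_sub_lt_one b
  by_cases hr : b - m = 0
  · rw [sub_eq_zero.1 hr]; exact hm
  exfalso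
  have hmem : ((b - m) * a) • q ∈ icosians := by
    have hsub : ((b - m) * a) • q = b • a • q - m • a • q := by
      ext1 <;> simp only [Quaternion.re_sub, Quaternion.imI_sub, Quaternion.imJ_sub,
        Quaternion.imK_sub, Quaternion.re_smul, Quaternion.imI_smul, Quaternion.imJ_smul,
        Quaternion.imK_smul, smul_eq_mul] <;> ring
    rw [hsub]
    exact icosians_sub_mem hb (icosians_smul_mem hm haq)
  obtain ⟨k, hk⟩ := exists_norm_eq_int (normSq_mem_of_mem_icosians hmem)
  refine Nat.find_min hex (m := k.natAbs) ?_ ⟨_, mul_ne_zero hr ha, hmem, by rw [hk]; simp⟩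
  have hpos : 0 < |QuadraticAlgebra.norm (Quaternion.normSq (a • q))| := by
    rw [abs_pos, Ne, QuadraticAlgebra.norm_eq_zero_iff_eq_zero]
    exact normSq_ne_zero (smul_ne_zero ha hq)
  have hk' : |QuadraticAlgebra.norm (Quaternion.normSq (((b - m) * a) • q))| = k.natAbs := by
    rw [hk]; simp
  rw [mul_smul, Quaternion.normSq_smul, map_mul, map_pow, abs_mul, abs_pow] at hk'
  rw [← Nat.cast_lt (α := ℚ), ← hk', ← hn]
  exact mul_lt_of_lt_one_left hpos (pow_lt_one₀ (abs_nonneg _) hlt two_ne_zero)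

/-! ### The twist length and admissibility -/

lemma twistLength_eq (q : ℍ[K]) : twistLength q = ‖embed q‖ * ‖embed (twist q)‖ := by
  rw [twistLength, embed_mul, norm_mul]

lemma normSq_twist (q : ℍ[K]) : Quaternion.normSq (twist q) = star (Quaternion.normSq q) := by
  simp only [Quaternion.normSq_def', star_add, star_pow, twist_re, twist_imI, twist_imJ, twist_imK]
  ring

/-- The twist conjugates the reduced norm, so the product of the two reduced norms is a field norm.
-/
lemma twistLength_sq (q : ℍ[K]) :
    twistLength q ^ 2 = (QuadraticAlgebra.norm (Quaternion.normSq q) : ℚ) := by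
  rw [twistLength_eq, mul_pow, sq, sq, ← Quaternion.normSq_eq_norm_mul_self,
    ← Quaternion.normSq_eq_norm_mul_self, ← toReal_normSq, ← toReal_normSq, normSq_twist,
    ← toReal_ratCast]
  simp only [← toRealHom_apply]
  rw [← map_mul, ← QuadraticAlgebra.algebraMap_norm_eq_mul_star]
  rfl

/-- A rational number whose square is an integer is an integer. -/
lemma isAdmissible_of_eq_ratCast {q : ℍ[K]} (hq : q ∈ icosians) {r : ℚ} (hr : 0 < r)
    (h : twistLength q = r) : IsAdmissible q := by
  obtain ⟨m, hm⟩ := exists_norm_eq_int (normSq_mem_of_mem_icosians hq)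
  have h2 := twistLength_sq q
  rw [hm, h] at h2
  have h3 : r ^ 2 = m := by exact_mod_cast h2
  have hd : r.den = 1 := by
    have := congrArg Rat.den h3
    rw [Rat.den_pow, Rat.den_intCast] at this
    exact (Nat.pow_eq_one.1 this).resolve_right two_ne_zero
  have hnum : (r.num.natAbs : ℚ) = r := by
    rw [Nat.cast_natAbs, abs_of_pos (Rat.num_pos.2 hr)]
    exact Rat.coe_int_num_of_den_eq_one hd
  refine ⟨r.num.natAbs, Int.natAbs_pos.2 (Rat.num_pos.2 hr).ne', ?_⟩
  rw [h, ← Rat.cast_natCast (α := ℝ), hnum]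

/-! ### Isometries of `ℍ` over `K` -/

/-- The basis quaternions of `ℍ[K]` embed as those of `ℍ[ℝ]`. -/
lemma embed_quat_ratCast (a b c d : ℚ) : embed (quat (a : K) b c d) = quat (a : ℝ) b c d := by
  ext <;> simp [toReal_ratCast]

lemma embed_i : embed (quat 0 1 0 0) = quat 0 1 0 0 := by simpa using embed_quat_ratCast 0 1 0 0
lemma embed_j : embed (quat 0 0 1 0) = quat 0 0 1 0 := by simpa using embed_quat_ratCast 0 0 1 0
lemma embed_k : embed (quat 0 0 0 1) = quat 0 0 0 1 := by simpa using embed_quat_ratCast 0 0 0 1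

/-- An explicit Skolem–Noether theorem with an intertwiner in a prescribed subring. -/
lemma exists_intertwiner (H : Subring ℍ[ℝ]) (hi : quat 0 1 0 0 ∈ H) (hj : quat 0 0 1 0 ∈ H)
    (hk : quat 0 0 0 1 ∈ H) {a b c : ℍ[ℝ]} (ha : a ∈ H) (hb : b ∈ H) (hc : c ∈ H)
    (haa : a * a = -1) (hbb : b * b = -1) (hab : a * b = c) (hba : b * a = -c) :
    ∃ g ∈ H, g ≠ 0 ∧ g * quat 0 1 0 0 = a * g ∧ g * quat 0 0 1 0 = b * g ∧
      g * quat 0 0 0 1 = c * g := by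
  set i : ℍ[ℝ] := quat 0 1 0 0 with hi'
  set j : ℍ[ℝ] := quat 0 0 1 0 with hj'
  set k : ℍ[ℝ] := quat 0 0 0 1 with hk'
  have hii : i * i = -1 := by ext <;> simp [hi']
  have hjj : j * j = -1 := by ext <;> simp [hj']
  have hij : i * j = k := by ext <;> simp [hi', hj', hk']
  have hji : j * i = -k := by ext <;> simp [hi', hj', hk']
  have hki : k * i = j := by ext <;> simp [hi', hj', hk']
  have hkj : k * j = -i := by ext <;> simp [hi', hj', hk']
  have hac : a * c = -b := by rw [← hab, ← mul_assoc, haa]; simp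
  have hbc : b * c = a := by rw [← hab, ← mul_assoc, hba, ← hab, neg_mul, mul_assoc, hbb]; simp
  -- Averaging w over the quaternion group, acting by a, b, c on the left and i, j, k on the right,
  -- yields an intertwiner.
  have key : ∀ w : ℍ[ℝ], (w - a * w * i - b * w * j - c * w * k) * i =
        a * (w - a * w * i - b * w * j - c * w * k) ∧
      (w - a * w * i - b * w * j - c * w * k) * j =
        b * (w - a * w * i - b * w * j - c * w * k) := fun w => by
    constructor
    · simp only [sub_mul, mul_sub, mul_assoc, hii, hji, hki]
      simp only [← mul_assoc, haa, hab, hac]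
      noncomm_ring
    · simp only [sub_mul, mul_sub, mul_assoc, hij, hjj, hkj]
      simp only [← mul_assoc, hba, hbb, hbc]
      noncomm_ring
  have hw : ∃ w ∈ H, w - a * w * i - b * w * j - c * w * k ≠ 0 := by
    by_contra! h
    have h1 := h 1 H.one_mem
    have h2 := h i hi
    have h3 := h j hj
    have h4 := h k hk
    -- Weighting the averages of 1, i, j, k by their conjugates cancels a, b, c and leaves 4, so the
    -- averages cannot all vanish.
    have h5 : (1 - a * 1 * i - b * 1 * j - c * 1 * k) - (i - a * i * i - b * i * j - c * i * k) * i
        - (j - a * j * i - b * j * j - c * j * k) * j - (k - a * k * i - b * k * j - c * k * k) * k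
        = quat 4 0 0 0 := by
      ext <;> simp [hi', hj', hk'] <;> ring
    rw [h1, h2, h3, h4] at h5
    have := congrArg (fun q : ℍ[ℝ] => q.re) h5
    simp at this
  obtain ⟨w, hwH, hw0⟩ := hw
  obtain ⟨k1, k2⟩ := key w
  refine ⟨w - a * w * i - b * w * j - c * w * k, ?_, hw0, k1, k2, ?_⟩
  · exact H.sub_mem (H.sub_mem (H.sub_mem hwH (H.mul_mem (H.mul_mem ha hwH) hi))
      (H.mul_mem (H.mul_mem hb hwH) hj)) (H.mul_mem (H.mul_mem hc hwH) hk)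
  · calc _ = (w - a * w * i - b * w * j - c * w * k) * i * j := by rw [mul_assoc _ i, hij]
      _ = _ := by rw [k1, mul_assoc, k2, ← mul_assoc, hab]

lemma eq_smul_basis (x : ℍ[ℝ]) : x = x.re • 1 + x.imI • quat 0 1 0 0 + x.imJ • quat 0 0 1 0 +
    x.imK • quat 0 0 0 1 := by
  ext <;> simp

/-- A linear isometry of `ℍ` fixing `1` and rational with respect to `ℍ[K]` is, up to conjugation,
an inner automorphism by an element of `ℍ[K]`. -/
lemma exists_conj_of_map_one (T : ℍ[ℝ] →ₗᵢ[ℝ] ℍ[ℝ]) (h1 : T 1 = 1)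
    (hi : T (quat 0 1 0 0) ∈ embedHom.range) (hj : T (quat 0 0 1 0) ∈ embedHom.range)
    (hk : T (quat 0 0 0 1) ∈ embedHom.range) :
    ∃ g : ℍ[K], embed g ≠ 0 ∧
      ((∀ x, embed g * x = T x * embed g) ∨ (∀ x, embed g * x = star (T x) * embed g)) := by
  have hre : ∀ v, (T v).re = v.re := fun v => by
    have := T.inner_map_map v 1
    simpa [h1, Quaternion.inner_def] using this
  -- A pure quaternion squares to minus its squared norm; polarising then shows that T preserves
  -- anticommutators.
  have hsq : ∀ v, v.re = 0 → T v * T v = v * v := fun v hv => by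
    have pure_sq : ∀ x : ℍ[ℝ], x.re = 0 → x * x = -((‖x‖ * ‖x‖ : ℝ) : ℍ[ℝ]) := fun x hx => by
      rw [← Quaternion.normSq_eq_norm_mul_self, ← Quaternion.self_mul_star,
        Quaternion.star_eq_neg.2 hx, mul_neg, neg_neg]
    rw [pure_sq _ ((hre v).trans hv), pure_sq v hv, T.norm_map]
  have hanti : ∀ v w, v.re = 0 → w.re = 0 → T v * T w + T w * T v = v * w + w * v :=
    fun v w hv hw => by
      have h := hsq (v + w) (by simp [hv, hw])
      rw [map_add, add_mul, mul_add, mul_add, hsq v hv, hsq w hw, add_mul, mul_add, mul_add] at h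
      have h' : v * v + (T v * T w + T w * T v) + w * w = v * v + (v * w + w * v) + w * w := by
        convert h using 1 <;> abel
      exact add_left_cancel (add_right_cancel h')
  set a := T (quat 0 1 0 0)
  set b := T (quat 0 0 1 0)
  set c := T (quat 0 0 0 1)
  have haa : a * a = -1 := by rw [hsq _ rfl]; ext <;> simp
  have hbb : b * b = -1 := by rw [hsq _ rfl]; ext <;> simp
  have hcc : c * c = -1 := by rw [hsq _ rfl]; ext <;> simp
  have hab : b * a = -(a * b) := by
    rw [eq_neg_iff_add_eq_zero, hanti _ _ rfl rfl]; ext <;> simp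
  have hac : c * a = -(a * c) := by
    rw [eq_neg_iff_add_eq_zero, hanti _ _ rfl rfl]; ext <;> simp
  have hbc : c * b = -(b * c) := by
    rw [eq_neg_iff_add_eq_zero, hanti _ _ rfl rfl]; ext <;> simp
  have hi' : (quat 0 1 0 0 : ℍ[ℝ]) ∈ embedHom.range := ⟨_, embed_i⟩
  have hj' : (quat 0 0 1 0 : ℍ[ℝ]) ∈ embedHom.range := ⟨_, embed_j⟩
  have hk' : (quat 0 0 0 1 : ℍ[ℝ]) ∈ embedHom.range := ⟨_, embed_k⟩
  have habab : a * b * (a * b) = -1 := by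
    rw [mul_assoc, ← mul_assoc b, hab, neg_mul, mul_assoc, hbb, mul_neg, mul_neg, mul_one,
      mul_neg, neg_neg, haa]
  have hcab : c * (a * b) = a * b * c := by
    rw [← mul_assoc, hac, neg_mul, mul_assoc, hbc, mul_neg, neg_neg, mul_assoc]
  -- c commutes with ab and both square to −1, so c = ±ab; the sign is the orientation of T.
  have hor : (c - a * b) * (c + a * b) = 0 := by
    rw [sub_mul, mul_add, mul_add, hcc, hcab, habab]; abel
  rcases mul_eq_zero.1 hor with h | h
  · rw [sub_eq_zero] at h
    obtain ⟨_, ⟨g, rfl⟩, hg, g1, g2, g3⟩ := exists_intertwiner embedHom.range hi' hj' hk' hi hj hk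
      haa hbb h.symm (by rw [hab, ← h])
    refine ⟨g, hg, Or.inl fun x => ?_⟩
    rw [embedHom_apply] at g1 g2 g3
    rw [eq_smul_basis x]
    simp only [map_add, map_smul, mul_add, add_mul, mul_smul_comm, smul_mul_assoc, h1, mul_one,
      one_mul, g1, g2, g3, a, b, c]
  · have h' : c = -(a * b) := eq_neg_of_add_eq_zero_left h
    -- Passing to −a, −b, −c, the images under `star ∘ T`, restores the multiplication table.
    obtain ⟨_, ⟨g, rfl⟩, hg, g1, g2, g3⟩ := exists_intertwiner embedHom.range hi' hj' hk'
      (neg_mem hi) (neg_mem hj) (neg_mem hk) (by rw [neg_mul_neg, haa]) (by rw [neg_mul_neg, hbb])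
      (by rw [neg_mul_neg, h', neg_neg]) (by rw [neg_mul_neg, hab, h', neg_neg])
    refine ⟨g, hg, Or.inr fun x => ?_⟩
    rw [embedHom_apply] at g1 g2 g3
    have sa : star a = -a := Quaternion.star_eq_neg.2 (hre _)
    have sb : star b = -b := Quaternion.star_eq_neg.2 (hre _)
    have sc : star c = -c := Quaternion.star_eq_neg.2 (hre _)
    rw [eq_smul_basis x]
    simp only [map_add, map_smul, mul_add, add_mul, mul_smul_comm, smul_mul_assoc, h1, mul_one,
      one_mul, star_add, Quaternion.star_smul, star_one]
    change _ = _ + _ • (star a * _) + _ • (star b * _) + _ • (star c * _)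
    rw [sa, sb, sc, g1, g2, g3]

/-- Cayley's description of the isometries of `ℝ⁴ = ℍ`, over `K`. -/
lemma exists_mul_mul_of_isometry (S : ℍ[ℝ] ≃ₗᵢ[ℝ] ℍ[ℝ]) (h1 : S 1 ∈ embedHom.range)
    (hi : S (quat 0 1 0 0) ∈ embedHom.range) (hj : S (quat 0 0 1 0) ∈ embedHom.range)
    (hk : S (quat 0 0 0 1) ∈ embedHom.range) :
    ∃ p q : ℍ[K], embed p ≠ 0 ∧ embed q ≠ 0 ∧ ((∀ x, S x = embed p * x * embed q) ∨
      (∀ x, star (S x) = embed p * x * embed q)) := by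
  obtain ⟨u, hu⟩ := h1
  rw [embedHom_apply] at hu
  have hnorm : ‖embed u‖ = 1 := by rw [hu, S.norm_map, norm_one]
  have hu0 : embed u ≠ 0 := fun h => by simp [h] at hnorm
  obtain ⟨v, -, -, hv⟩ := exists_inverse (q := u) (fun h => hu0 (by rw [h, embed_zero]))
  -- Dividing by the unit quaternion S 1 reduces to an isometry fixing 1.
  let T : ℍ[ℝ] →ₗᵢ[ℝ] ℍ[ℝ] :=
    ⟨LinearMap.mulLeft ℝ (embed v) ∘ₗ S.toLinearEquiv.toLinearMap, fun x => by
      simp [hv, hnorm]⟩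
  have hT : ∀ x, T x = embed v * S x := fun x => rfl
  have hv' : embed v ∈ embedHom.range := ⟨v, rfl⟩
  have hST : ∀ x, S x = embed u * T x := fun x => by
    rw [hT, hv, mul_inv_cancel_left₀ hu0]
  obtain ⟨g, hg, h⟩ := exists_conj_of_map_one T (by rw [hT, ← hu, hv, inv_mul_cancel₀ hu0])
    (mul_mem hv' hi) (mul_mem hv' hj) (mul_mem hv' hk)
  obtain ⟨k, -, -, hk⟩ := exists_inverse (q := g) (fun h => hg (by rw [h, embed_zero]))
  have hk0 : embed k ≠ 0 := hk ▸ inv_ne_zero hg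
  rcases h with h | h
  · refine ⟨u * g, k, ?_, hk0, Or.inl fun x => ?_⟩
    · rw [embed_mul]; exact mul_ne_zero hu0 hg
    · rw [embed_mul, hST, mul_assoc (embed u), h, mul_assoc, mul_assoc, hk, mul_inv_cancel₀ hg,
        mul_one]
  · refine ⟨g, k * star u, hg, ?_, Or.inr fun x => ?_⟩
    · rw [embed_mul, embed_star]; exact mul_ne_zero hk0 (star_ne_zero.2 hu0)
    · rw [embed_mul, embed_star, hST, star_mul, h, ← mul_assoc, mul_assoc _ (embed g), hk,
        mul_inv_cancel₀ hg, mul_one]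

/-! ### Twisted conjugations -/

/-- The map `x ↦ c · r x r̃` on `ℍ(ℝ)`. -/
def twistedConj (c : ℝ) (r : ℍ[K]) (x : ℍ[ℝ]) : ℍ[ℝ] :=
  c • (embed r * x * embed (twist r))

lemma rotatedL_eq_image (q : ℍ[K]) :
    rotatedL q = twistedConj (1 / twistLength q) q '' (L : Set ℍ[ℝ]) := rfl

lemma norm_twistedConj (c : ℝ) (r : ℍ[K]) (x : ℍ[ℝ]) :
    ‖twistedConj c r x‖ = |c| * twistLength r * ‖x‖ := by
  rw [twistedConj, norm_smul, norm_mul, norm_mul, twistLength_eq, Real.norm_eq_abs]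
  ring

lemma ne_zero_of_embed_ne_zero {q : ℍ[K]} (h : embed q ≠ 0) : q ≠ 0 := fun h' =>
  h (by rw [h', embed_zero])

lemma embed_ne_zero {q : ℍ[K]} (h : q ≠ 0) : embed q ≠ 0 := fun h' =>
  h (embed_injective (h'.trans embed_zero.symm))

lemma twist_eq_zero_iff {q : ℍ[K]} : twist q = 0 ↔ q = 0 := by
  have h0 : twist 0 = 0 := by ext <;> simp
  exact ⟨fun h => by rw [← twist_twist q, h, h0], fun h => by rw [h, h0]⟩

/-- A quaternion that commutes with `i` and `j + k` is central. -/
lemma eq_smul_one_of_commute {h : ℍ[K]} (hi : h * quat 0 1 0 0 = quat 0 1 0 0 * h)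
    (hjk : h * quat 0 0 1 1 = quat 0 0 1 1 * h) : h = h.re • 1 := by
  have e1 := congrArg (fun q : ℍ[K] => q.imJ) hi
  have e2 := congrArg (fun q : ℍ[K] => q.imK) hi
  have e3 := congrArg (fun q : ℍ[K] => q.imJ) hjk
  simp only [Quaternion.imJ_mul, Quaternion.imK_mul, quat_re, quat_imI, quat_imJ, quat_imK] at e1 e2 e3
  have two : (2 : K) ≠ 0 := two_ne_zero
  have f1 : h.imK = 0 := mul_left_cancel₀ two (by linear_combination e1)
  have f2 : h.imJ = 0 := mul_left_cancel₀ two (by linear_combination -e2)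
  have f3 : h.imI = 0 := mul_left_cancel₀ two (by linear_combination -e3)
  ext1 <;> simp only [Quaternion.re_smul, Quaternion.imI_smul, Quaternion.imJ_smul,
    Quaternion.imK_smul, smul_eq_mul, Quaternion.re_one, Quaternion.imI_one, Quaternion.imJ_one,
    Quaternion.imK_one, f1, f2, f3, mul_zero, mul_one]

/-- A map `x ↦ p x q` which preserves the twist-fixed quaternions is a twisted conjugation. -/
lemma exists_twistedConj_eq {p q : ℍ[K]} (hp : embed p ≠ 0) (hq : embed q ≠ 0)
    (h : ∀ y, twist y = y → twist (p * y * q) = p * y * q) :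
    ∃ (c : ℚ) (r : ℍ[K]), c ≠ 0 ∧ r ≠ 0 ∧
      ∀ x, embed p * x * embed q = twistedConj c r x := by
  replace hp := ne_zero_of_embed_ne_zero hp
  replace hq := ne_zero_of_embed_ne_zero hq
  set r := twist q with hr
  have hrq : twist r = q := twist_twist q
  have hr0 : r ≠ 0 := fun h0 => hq (twist_eq_zero_iff.1 h0)
  obtain ⟨s, hsr, hrs, -⟩ := exists_inverse hr0
  obtain ⟨t, htq, hqt, -⟩ := exists_inverse hq
  have key : ∀ y, twist y = y → p * y = r * y * (twist p * t) := fun y hy => by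
    have h1 := h y hy
    rw [twist_mul, twist_mul, hy, ← hr] at h1
    calc p * y = p * y * q * t := by rw [mul_assoc _ q, hqt, mul_one]
      _ = _ := by rw [← h1]; simp only [mul_assoc]
  set m := twist p * t
  -- With y = 1 this gives p = r m; then m commutes with every twist-fixed element, hence is
  -- central.
  have hpm : p = r * m := by simpa using key 1 twist_one
  have hcomm : ∀ y, twist y = y → m * y = y * m := fun y hy => by
    have h1 := key y hy
    rw [hpm] at h1
    calc m * y = s * r * (m * y) := by rw [hsr, one_mul]
      _ = s * (r * m * y) := by simp only [mul_assoc]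
      _ = s * r * (y * m) := by rw [h1]; simp only [mul_assoc]
      _ = y * m := by rw [hsr, one_mul]
  have hm := eq_smul_one_of_commute (hcomm (quat 0 1 0 0) (by
      ext <;> simp [QuadraticAlgebra.re_one, QuadraticAlgebra.im_one]))
    (hcomm (quat 0 0 1 1) (by ext <;> simp [QuadraticAlgebra.re_one, QuadraticAlgebra.im_one]))
  set a := m.re
  have hpr : p = a • r := embed_injective (by
    rw [hpm, hm, embed_mul, embed_smul, embed_smul, embed_one, mul_smul_comm, mul_one])
  have ha0 : a ≠ 0 := fun h0 => hp (by rw [hpr, h0]; ext <;> simp)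
  have hrr : r * twist r ≠ 0 := fun h0 => by
    have := congrArg embed h0
    rw [embed_mul, embed_zero, mul_eq_zero] at this
    rcases this with h' | h'
    · exact embed_ne_zero hr0 h'
    · rw [hrq] at h'; exact embed_ne_zero hq h'
  have h1 := h 1 twist_one
  have hsmul : a • r * q = a • (r * q) := embed_injective (by
    simp only [embed_mul, embed_smul, smul_mul_assoc])
  rw [mul_one, hpr, hsmul, twist_smul, ← hrq, twist_mul, twist_twist] at h1
  -- Both r r̃ and a · r r̃ are twist-fixed, so a equals its conjugate and is rational.
  have hastar : star a = a := by
    have := congrArg embed h1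
    rw [embed_smul, embed_smul] at this
    exact toReal_injective (smul_left_injective ℝ (embed_ne_zero hrr) this)
  obtain ⟨c, hc⟩ := exists_ratCast_eq hastar
  refine ⟨c, r, fun h0 => ha0 (by rw [hc, h0, Rat.cast_zero]), hr0, fun x => ?_⟩
  rw [twistedConj, hrq, hpr, embed_smul, hc, toReal_ratCast, smul_mul_assoc, smul_mul_assoc]

lemma twistedConj_inverse {r s : ℍ[K]} (hrs : r * s = 1) {c : ℝ} (hc : c ≠ 0) (x : ℍ[ℝ]) :
    twistedConj c r (twistedConj c⁻¹ s x) = x := by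
  have h1 : embed r * embed s = 1 := by rw [← embed_mul, hrs, embed_one]
  have h2 : embed (twist s) * embed (twist r) = 1 := by
    rw [← embed_mul, ← twist_mul, hrs, twist_one, embed_one]
  rw [twistedConj, twistedConj, mul_smul_comm, smul_mul_assoc, smul_smul, mul_inv_cancel₀ hc,
    one_smul]
  calc _ = embed r * embed s * x * (embed (twist s) * embed (twist r)) := by
        simp only [mul_assoc]
    _ = x := by rw [h1, h2, one_mul, mul_one]

/-- The two factors contribute a and a′, whose product is rational; hence making r primitive keeps
the scalar rational. -/
lemma twistedConj_smul (c : ℝ) (a : K) (r : ℍ[K]) (x : ℍ[ℝ]) :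
    twistedConj c (a • r) x = twistedConj (c * (QuadraticAlgebra.norm a : ℚ)) r x := by
  have h : ((QuadraticAlgebra.norm a : ℚ) : ℝ) = toReal a * toReal (star a) := by
    rw [← toReal_ratCast]
    simp only [← toRealHom_apply]
    rw [← map_mul, ← QuadraticAlgebra.algebraMap_norm_eq_mul_star]
    rfl
  rw [twistedConj, twistedConj, twist_smul, embed_smul, embed_smul, h, smul_mul_assoc,
    smul_mul_assoc, mul_smul_comm, smul_smul, smul_smul, mul_assoc]

lemma twistedConj_neg_image (c : ℝ) (r : ℍ[K]) :
    twistedConj (-c) r '' (L : Set ℍ[ℝ]) = twistedConj c r '' (L : Set ℍ[ℝ]) := by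
  have h : ∀ x, twistedConj (-c) r x = twistedConj c r (-x) := fun x => by
    simp [twistedConj]
  ext z
  constructor
  · rintro ⟨x, hx, rfl⟩
    exact ⟨-x, neg_mem hx, (h x).symm⟩
  · rintro ⟨x, hx, rfl⟩
    exact ⟨-x, neg_mem hx, by rw [h, neg_neg]⟩

/-- An isometric rational twisted conjugation maps `L` to `rotatedL q` for a primitive admissible
icosian `q`. -/
lemma exists_rotatedL_eq {c : ℚ} {r : ℍ[K]} (hr : r ≠ 0)
    (hn : |(c : ℝ)| * twistLength r = 1) :
    ∃ q ∈ icosians, IsPrimitive q ∧ IsAdmissible q ∧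
      twistedConj c r '' (L : Set ℍ[ℝ]) = rotatedL q := by
  obtain ⟨a, ha, hmem, hprim⟩ := exists_smul_isPrimitive hr
  have hr' : r = a⁻¹ • (a • r) := by
    rw [← mul_smul, inv_mul_cancel₀ ha, one_smul]
  set q := a • r
  set d : ℚ := c * QuadraticAlgebra.norm a⁻¹ with hd
  have hfun : twistedConj c r = twistedConj d q := by
    funext x
    conv_lhs => rw [hr', twistedConj_smul]
    rw [hd, Rat.cast_mul]
  -- Compare the norms of the image of 1 in the two descriptions of the map.
  have hdn : |(d : ℝ)| * twistLength q = 1 := by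
    have h1 := norm_twistedConj c r 1
    rw [hfun, norm_twistedConj, hn] at h1
    simpa using h1
  have hd0 : d ≠ 0 := fun h0 => by simp [h0] at hdn
  have hq : twistLength q = (|d|⁻¹ : ℚ) := by
    rw [Rat.cast_inv, Rat.cast_abs]
    exact eq_inv_of_mul_eq_one_right hdn
  refine ⟨q, hmem, hprim, isAdmissible_of_eq_ratCast hmem (by positivity) hq, ?_⟩
  rw [rotatedL_eq_image, hfun, hq, Rat.cast_inv, Rat.cast_abs, one_div, inv_inv]
  rcases abs_choice (d : ℝ) with h | h
  · rw [h]
  · rw [h, twistedConj_neg_image]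

/-! ### Coincidence isometries and twisted conjugations -/

lemma coe_isometryImage (R : ℍ[ℝ] ≃ₗᵢ[ℝ] ℍ[ℝ]) (Γ : Submodule ℤ ℍ[ℝ]) :
    (isometryImage R Γ : Set ℍ[ℝ]) = R '' Γ := rfl

/-- The rational span of `L` is preserved by the inverse of a coincidence isometry. -/
lemma IsCoincidenceIsometry.exists_embed_eq {R : ℍ[ℝ] ≃ₗᵢ[ℝ] ℍ[ℝ]}
    (hR : IsCoincidenceIsometry L R) {y : ℍ[K]} (hy : twist y = y) :
    ∃ z, twist z = z ∧ embed z = R.symm (embed y) := by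
  obtain ⟨n, hn, hmem⟩ := exists_nsmul_embed_mem_L hy
  -- Finite index puts a further multiple of y in R L, so its preimage lies in `L`.
  obtain ⟨k, hk, -, hkmem⟩ := AddSubgroup.exists_nsmul_mem_of_relIndex_ne_zero hR
    (a := n • embed y) hmem
  obtain ⟨x, hx, hxy⟩ := hkmem.1.2
  change R x = _ at hxy
  obtain ⟨w, hw, rfl⟩ := exists_embed_eq_of_mem_L hx
  have hkn : (((k * n : ℕ) : ℚ)) ≠ 0 := by
    exact_mod_cast mul_ne_zero hk.ne' hn
  refine ⟨((((k * n : ℕ) : ℚ)⁻¹ : ℚ) : K) • w, by rw [twist_smul, hw, star_ratCast], ?_⟩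
  rw [embed_smul, toReal_ratCast]
  apply R.injective
  rw [map_smul, hxy, R.apply_symm_apply, ← mul_smul, ← Nat.cast_smul_eq_nsmul ℝ, smul_smul]
  push_cast at hkn ⊢
  rw [inv_mul_cancel₀ (by exact_mod_cast hkn), one_smul]

lemma exists_rotatedL_of_isCoincidenceIsometry {R : ℍ[ℝ] ≃ₗᵢ[ℝ] ℍ[ℝ]}
    (hR : IsCoincidenceIsometry L R) :
    ∃ q ∈ icosians, IsPrimitive q ∧ IsAdmissible q ∧
      (isometryImage R L : Set ℍ[ℝ]) = rotatedL q := by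
  have hV : ∀ y, twist y = y → R.symm (embed y) ∈ embedHom.range := fun y hy => by
    obtain ⟨z, -, hz⟩ := hR.exists_embed_eq hy
    exact ⟨z, hz⟩
  have h1 := hV 1 twist_one
  rw [embed_one] at h1
  have hi := hV (quat 0 1 0 0)
    (by ext <;> simp [QuadraticAlgebra.re_one, QuadraticAlgebra.im_one])
  rw [embed_i] at hi
  have hs := hV (quat 0 0 1 1)
    (by ext <;> simp [QuadraticAlgebra.re_one, QuadraticAlgebra.im_one])
  -- √5(j − k) is twist-fixed; with j + k it yields j and k over `K`, and R⁻¹ is real linear.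
  have hd := hV (quat 0 0 ⟨0, 1⟩ ⟨0, -1⟩) (by ext <;> simp)
  have hsm : ∀ (a : K) (x : ℍ[ℝ]), x ∈ embedHom.range → toReal a • x ∈ embedHom.range := by
    rintro a _ ⟨x, rfl⟩
    exact ⟨a • x, embed_smul a x⟩
  have h5 : √(5 : ℝ) * √5 = 5 := Real.mul_self_sqrt (by norm_num)
  have hj : R.symm (quat 0 0 1 0) ∈ embedHom.range := by
    have e : (quat 0 0 1 0 : ℍ[ℝ]) = toReal ⟨1 / 2, 0⟩ • embed (quat 0 0 1 1) +
        toReal ⟨0, 1 / 10⟩ • embed (quat 0 0 ⟨0, 1⟩ ⟨0, -1⟩) := by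
      ext <;> simp [toReal, QuadraticAlgebra.re_one, QuadraticAlgebra.im_one] <;> linarith
    rw [e, map_add, map_smul, map_smul]
    exact add_mem (hsm _ _ hs) (hsm _ _ hd)
  have hk : R.symm (quat 0 0 0 1) ∈ embedHom.range := by
    have e : (quat 0 0 0 1 : ℍ[ℝ]) = toReal ⟨1 / 2, 0⟩ • embed (quat 0 0 1 1) +
        toReal ⟨0, -1 / 10⟩ • embed (quat 0 0 ⟨0, 1⟩ ⟨0, -1⟩) := by
      ext <;> simp [toReal, QuadraticAlgebra.re_one, QuadraticAlgebra.im_one] <;> linarith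
    rw [e, map_add, map_smul, map_smul]
    exact add_mem (hsm _ _ hs) (hsm _ _ hd)
  obtain ⟨p, q, hp, hq, hpq⟩ := exists_mul_mul_of_isometry R.symm h1 hi hj hk
  have hfix : ∀ y, twist y = y → twist (p * y * q) = p * y * q := fun y hy => by
    obtain ⟨z, hz, hzy⟩ := hR.exists_embed_eq hy
    rcases hpq with h | h
    · have : p * y * q = z := embed_injective (by rw [hzy, h, embed_mul, embed_mul])
      rw [this, hz]
    · have : p * y * q = star z := embed_injective (by
        rw [embed_star, hzy, h, embed_mul, embed_mul])
      rw [this, twist_star, hz]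
  obtain ⟨c, r, hc, hr, hcr⟩ := exists_twistedConj_eq hp hq hfix
  obtain ⟨s, hsr, hrs, -⟩ := exists_inverse hr
  have hc' : (c : ℝ) ≠ 0 := by exact_mod_cast hc
  have hs0 : s ≠ 0 := fun h0 => by rw [h0, mul_zero] at hrs; exact zero_ne_one hrs
  have hinj : ∀ x y, twistedConj c r x = twistedConj c r y → x = y := fun x y hxy => by
    rw [← hcr, ← hcr] at hxy
    exact mul_left_cancel₀ hp (mul_right_cancel₀ hq hxy)
  have hnorm : ∀ x, ‖twistedConj c r x‖ = ‖x‖ := fun x => by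
    rw [← hcr]
    rcases hpq with h | h
    · rw [← h, R.symm.norm_map]
    · rw [← h, norm_star, R.symm.norm_map]
  have hn : |((c⁻¹ : ℚ) : ℝ)| * twistLength s = 1 := by
    have h2 := norm_twistedConj (c : ℝ)⁻¹ s 1
    rw [← hnorm, twistedConj_inverse hrs hc', norm_one, mul_one] at h2
    rw [Rat.cast_inv, ← h2]
  obtain ⟨q', hq', hprim, hadm, himg⟩ := exists_rotatedL_eq hs0 hn
  refine ⟨q', hq', hprim, hadm, ?_⟩
  rw [← himg, coe_isometryImage, Rat.cast_inv]
  rcases hpq with h | h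
  · refine Set.image_congr fun x _ => hinj _ _ ?_
    rw [twistedConj_inverse hrs hc', ← hcr, ← h, R.symm_apply_apply]
  -- Orientation-reversing case: R is a twisted conjugation after `star`, which maps `L` onto
  -- itself.
  · have hR : ∀ x, R x = twistedConj (c : ℝ)⁻¹ s (star x) := fun x => hinj _ _ (by
      rw [twistedConj_inverse hrs hc', ← hcr, ← h, R.symm_apply_apply])
    ext z
    constructor
    · rintro ⟨x, hx, rfl⟩
      exact ⟨star x, star_mem_L hx, (hR x).symm⟩
    · rintro ⟨x, hx, rfl⟩
      exact ⟨star x, star_mem_L hx, by rw [hR, star_star]⟩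

/-- `twistedConj c r` as a linear isometry equivalence. -/
def twistedConjIsometry (c : ℝ) (r : ℍ[K]) (h : |c| * twistLength r = 1) :
    ℍ[ℝ] ≃ₗᵢ[ℝ] ℍ[ℝ] :=
  LinearIsometry.toLinearIsometryEquiv
    ⟨{ toFun := twistedConj c r
       map_add' := fun x y => by simp only [twistedConj, mul_add, add_mul, smul_add]
       map_smul' := fun a x => by
        simp only [twistedConj, mul_smul_comm, smul_mul_assoc, RingHom.id_apply, smul_comm c a] },
      fun x => (norm_twistedConj c r x).trans (by rw [h, one_mul])⟩ rfl

lemma twistedConjIsometry_apply (c : ℝ) (r : ℍ[K]) (h : |c| * twistLength r = 1) (x : ℍ[ℝ]) :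
    twistedConjIsometry c r h x = twistedConj c r x := rfl

/-- The quotient of `L` by the intersection is finitely generated and torsion, hence finite. -/
lemma isCoincidenceIsometry_of_forall_nsmul_mem {R : ℍ[ℝ] ≃ₗᵢ[ℝ] ℍ[ℝ]}
    (h : ∀ x ∈ L, ∃ n : ℕ, n ≠ 0 ∧ n • x ∈ isometryImage R L) : IsCoincidenceIsometry L R := by
  have hfg : L.FG := Submodule.fg_span (by simp)
  have : Module.Finite ℤ L := Module.Finite.iff_fg.2 hfg
  set N : Submodule ℤ L := (L ⊓ isometryImage R L).comap L.subtype
  have hfin : Finite (L ⧸ N) := by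
    refine Module.finite_of_fg_torsion _ fun x => ?_
    obtain ⟨x, rfl⟩ := N.mkQ_surjective x
    obtain ⟨n, hn, hx⟩ := h x x.2
    refine ⟨⟨n, mem_nonZeroDivisors_of_ne_zero (by exact_mod_cast hn)⟩, ?_⟩
    change (n : ℤ) • N.mkQ x = 0
    rw [← map_smul, Submodule.mkQ_apply, Submodule.Quotient.mk_eq_zero]
    refine ⟨L.smul_mem (n : ℤ) x.2, ?_⟩
    simpa using hx
  have : N.toAddSubgroup.FiniteIndex := by
    have : Finite (L.toAddSubgroup ⧸ N.toAddSubgroup) := hfin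
    exact AddSubgroup.finiteIndex_of_finite_quotient
  exact this.index_ne_zero

lemma isCoincidenceIsometry_twistedConjIsometry {c : ℚ} {r : ℍ[K]} (hc : c ≠ 0) (hr : r ≠ 0)
    (h : |(c : ℝ)| * twistLength r = 1) :
    IsCoincidenceIsometry L (twistedConjIsometry c r h) := by
  obtain ⟨s, hsr, hrs, -⟩ := exists_inverse hr
  refine isCoincidenceIsometry_of_forall_nsmul_mem fun x hx => ?_
  obtain ⟨y, hy, rfl⟩ := exists_embed_eq_of_mem_L hx
  -- The inverse map, given by s and c⁻¹, preserves twist-fixed elements, so a multiple of the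
  -- preimage lies in `L`.
  have hfix : twist (((c⁻¹ : ℚ) : K) • (s * y * twist s)) =
      ((c⁻¹ : ℚ) : K) • (s * y * twist s) := by
    rw [twist_smul, star_ratCast, twist_mul, twist_mul, twist_twist, hy, mul_assoc]
  obtain ⟨n, hn, hmem⟩ := exists_nsmul_embed_mem_L hfix
  refine ⟨n, hn, _, hmem, ?_⟩
  change twistedConjIsometry c r h _ = _
  rw [map_nsmul, twistedConjIsometry_apply]
  congr 1
  rw [embed_smul, toReal_ratCast, embed_mul, embed_mul, Rat.cast_inv]
  exact twistedConj_inverse hrs (by exact_mod_cast hc) _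

end A4CSL

end

theorem mainTheorem5 (Λ : Submodule ℤ ℍ[ℝ]) :
    A4CSL.IsCSL A4CSL.L Λ ↔
      ∃ q : ℍ[A4CSL.K], q ∈ A4CSL.icosians ∧ A4CSL.IsPrimitive q ∧ A4CSL.IsAdmissible q ∧
        (Λ : Set ℍ[ℝ]) = (A4CSL.L : Set ℍ[ℝ]) ∩ A4CSL.rotatedL q := by
  open A4CSL in
  constructor
  · rintro ⟨R, hR, rfl⟩
    obtain ⟨q, hq, hprim, hadm, himg⟩ := exists_rotatedL_of_isCoincidenceIsometry hR
    exact ⟨q, hq, hprim, hadm, by rw [Submodule.coe_inf, himg]⟩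
  · rintro ⟨q, -, -, ⟨n, hn, hq⟩, hΛ⟩
    have hn' : (0 : ℝ) < n := by exact_mod_cast hn
    have hq0 : q ≠ 0 := fun h0 => by
      rw [twistLength_eq, h0, embed_zero, norm_zero, zero_mul] at hq
      exact hn'.ne hq
    -- Admissibility makes the normalising scalar rational.
    have hcast : (((1 / n : ℚ)) : ℝ) = 1 / twistLength q := by rw [hq]; push_cast; rfl
    have hnorm : |((1 / n : ℚ) : ℝ)| * twistLength q = 1 := by
      rw [hcast, hq, abs_of_pos (by positivity), one_div, inv_mul_cancel₀ hn'.ne']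
    refine ⟨_, isCoincidenceIsometry_twistedConjIsometry (by positivity) hq0 hnorm,
      SetLike.ext' ?_⟩
    rw [hΛ, Submodule.coe_inf, coe_isometryImage, rotatedL_eq_image, ← hcast]
    rfl
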